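/- For $d \ge 1$ let $\Delta_d = \{\mathbf 0, e_1, \dots, e_d\} \subset \mathbb{Z}^d$ be the vertex set of the standard simplex in $\mathbb{R}^d$. A polyhedron is the solution set in $\mathbb{R}^d$ of a finite system of linear inequalities with real coefficients and real right-hand sides; it is rational if the system can be chosen with rational coefficients and right-hand sides. For $X \subseteq \mathbb{Z}^d$, the relaxation complexity $\operatorname{rc}(X)$ is the least number of facets of a polyhedron $P \subseteq \mathbb{R}^d$ with $P \cap \mathbb{Z}^d = X$ (and $\infty$ if there is no such $P$), and the rational relaxation complexity $\operatorname{rc}_{\mathbb{Q}}(X)$ is the least number of facets of a rational polyhedron $P \subseteq \mathbb{R}^d$ with $P \cap \mathbb{Z}^d = X$ (and $\infty$ if there is no such $P$). Then $\operatorname{rc}(\Delta_d)$ and $\operatorname{rc}_{\mathbb{Q}}(\Delta_d)$ are finite, $\operatorname{rc}_{\mathbb{Q}}(\Delta_d) \neq 0$, and, as $d \to \infty$, $$\operatorname{rc}(\Delta_d) \in O\!\left(\frac{d}{\sqrt{\log d}}\right) \qquad\text{and}\qquad \frac{\operatorname{rc}(\Delta_d)}{\operatorname{rc}_{\mathbb{Q}}(\Delta_d)}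 \longrightarrow 0 .$$ -/

import Mathlib

open Filter Topology Asymptotics

/-- A polyhedron in `ℝ^d`: the solution set of a finite system `A x ≤ b` of linear inequalities
with real coefficients. -/
def IsPolyhedron {d : ℕ} (P : Set (Fin d → ℝ)) : Prop :=
  ∃ (m : ℕ) (A : Matrix (Fin m) (Fin d) ℝ) (b : Fin m → ℝ),
    P = {x | ∀ i, A i ⬝ᵥ x ≤ b i}

/-- A rational polyhedron in `ℝ^d`: the solution set in `ℝ^d` of a finite system `A x ≤ b` of
linear inequalities with rational coefficients and rational right-hand sides. -/
def IsRationalPolyhedron {d : ℕ} (P : Set (Fin d → ℝ)) : Prop :=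
  ∃ (m : ℕ) (A : Matrix (Fin m) (Fin d) ℚ) (b : Fin m → ℚ),
    P = {x | ∀ i, (fun j => (A i j : ℝ)) ⬝ᵥ x ≤ (b i : ℝ)}

/-- The dimension of the affine hull of `S` (used for nonempty `S` only). -/
noncomputable def affDim {d : ℕ} (S : Set (Fin d → ℝ)) : ℕ :=
  Module.finrank ℝ (vectorSpan ℝ S)

/-- `F` is a face of `P` cut out by a valid inequality: `a · x ≤ β` holds on all of `P`, and `F` is
the set of points of `P` at which equality holds. -/
def IsFace {d : ℕ} (P F : Set (Fin d → ℝ)) : Prop :=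
  ∃ (a : Fin d → ℝ) (β : ℝ), (∀ x ∈ P, a ⬝ᵥ x ≤ β) ∧ F = {x | x ∈ P ∧ a ⬝ᵥ x = β}

/-- A facet of `P`: a nonempty face of dimension `dim P - 1`. -/
def IsFacet {d : ℕ} (P F : Set (Fin d → ℝ)) : Prop :=
  IsFace P F ∧ F.Nonempty ∧ affDim F + 1 = affDim P

/-- The number of facets of `P`. -/
noncomputable def numFacets {d : ℕ} (P : Set (Fin d → ℝ)) : ℕ∞ :=
  Set.encard {F : Set (Fin d → ℝ) | IsFacet P F}

/-- The relaxation complexity `rc(X, Y)` of `X` within `Y`: the least number of facets of a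
polyhedron `P` with `X = P ∩ Y`, and `∞` if there is no such polyhedron. -/
noncomputable def rcWithin {d : ℕ} (X Y : Set (Fin d → ℝ)) : ℕ∞ :=
  sInf {k : ℕ∞ | ∃ P : Set (Fin d → ℝ), IsPolyhedron P ∧ X = P ∩ Y ∧ numFacets P = k}

/-- The same minimum over rational polyhedra only. -/
noncomputable def rcRatWithin {d : ℕ} (X Y : Set (Fin d → ℝ)) : ℕ∞ :=
  sInf {k : ℕ∞ | ∃ P : Set (Fin d → ℝ), IsRationalPolyhedron P ∧ X = P ∩ Y ∧ numFacets P = k}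

/-- The integer points of `ℝ^d`. -/
def integerPoints (d : ℕ) : Set (Fin d → ℝ) :=
  Set.range fun (z : Fin d → ℤ) (i : Fin d) => (z i : ℝ)

/-- The relaxation complexity of a set of integer points. -/
noncomputable def rc {d : ℕ} (X : Set (Fin d → ℝ)) : ℕ∞ :=
  rcWithin X (integerPoints d)

/-- The rational relaxation complexity of a set of integer points. -/
noncomputable def rcRat {d : ℕ} (X : Set (Fin d → ℝ)) : ℕ∞ :=
  rcRatWithin X (integerPoints d)

/-- `Δ_d = {0, e_1, …, e_d}`, the vertex set of the standard simplex in `ℝ^d`. -/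
def stdSimplexVertices (d : ℕ) : Set (Fin d → ℝ) :=
  insert 0 (Set.range fun i : Fin d => Pi.single i (1 : ℝ))

/-!
The proof rests on an explicit irrational relaxation of `Δ_d` with `O(√d)` inequalities, which is
more than the asymptotic claims need, and on the bound `rc_ℚ(Δ_d) ≥ d + 1`.

*Upper bound.* Let `s` satisfy `d + 1 ≤ s²` and place the `d + 1` vertices injectively on the grid
`S × S`, where `|S| = s`. In the barycentric coordinates `t` of a point, ask that all row sums and
all column sums be nonnegative. For an integer point, the row sums are nonnegative integers with
total `1`, so they form a unit vector, and likewise for the columns; this singles out a cell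
`(i₀, j₀)`. Choose reals `h (i, j)` that are linearly independent over `ℚ`. For each column `j` ask
in addition that `∑ t h` and `∑ i, (row sum i) * h (i, j)` differ by at most `M (1 - column sum j)`;
for large `M` this holds at all vertices. For `j = j₀` it forces `∑ t h = h (i₀, j₀)`, and linear
independence then forces `t` to be the unit vector at the cell `(i₀, j₀)`. Altogether these are `4 s`
inequalities (`gridFun`, `exists_sum_eq_of_gridFun`, `simplexCoord_eq_of_sum_eq`).

*Lower bound.* If at most `d` rational inequalities describe a set containing `Δ_d`, their
homogeneous versions have a nonzero integer solution `v`, and then the relaxation contains the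
integer points `v` and `2 v`, which are not both in `Δ_d`
(`add_one_le_numFacets_of_isRationalPolyhedron`).

Both bounds concern inequalities, while `rc` counts facets. Since `Δ_d` affinely spans the space,
every relaxation is full-dimensional, so the number of facets is at most the length of any
describing system (`numFacets_le_card`) and at least the length of an irredundant one
(`card_le_numFacets`).
-/

/-! ### Facets and describing inequalities -/

theorem affDim_eq_of_vectorSpan_eq_top {d : ℕ} {P : Set (Fin d → ℝ)} (h : vectorSpan ℝ P = ⊤) :
    affDim P = d := by
  rw [affDim, h]
  simp

theorem dotProduct_eq_zero_of_mem_vectorSpan {d : ℕ} {S : Set (Fin d → ℝ)} {a v : Fin d → ℝ}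
    {β : ℝ} (hS : ∀ x ∈ S, a ⬝ᵥ x = β) (hv : v ∈ vectorSpan ℝ S) : a ⬝ᵥ v = 0 := by
  have hle : vectorSpan ℝ S ≤ LinearMap.ker (dotProductBilin ℝ ℝ a) := by
    rw [vectorSpan_def, Submodule.span_le]
    rintro _ ⟨x, hx, y, hy, rfl⟩
    simp [dotProduct_sub, hS x hx, hS y hy]
  simpa using hle hv

theorem finrank_ker_dotProduct {d : ℕ} {a : Fin d → ℝ} (ha : a ≠ 0) :
    Module.finrank ℝ (LinearMap.ker (dotProductBilin ℝ ℝ a)) + 1 = d := by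
  have h : (dotProductBilin ℝ ℝ a : Module.Dual ℝ (Fin d → ℝ)) ≠ 0 := by
    intro h
    exact ha (dotProduct_self_eq_zero.mp (by simpa using LinearMap.congr_fun h a))
  simpa using Module.Dual.finrank_ker_add_one_of_ne_zero h

/-- Moving a little from a point where finitely many inequalities are strict keeps them strict. -/
theorem exists_pos_forall_dotProduct_add_smul_lt {d : ℕ} {κ : Type*} [Finite κ]
    (a : κ → Fin d → ℝ) (b : κ → ℝ) (x v : Fin d → ℝ) (hx : ∀ k, a k ⬝ᵥ x < b k) :
    ∃ ε : ℝ, 0 < ε ∧ ∀ k, a k ⬝ᵥ (x + ε • v) < b k := by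
  have h : ∀ᶠ ε : ℝ in 𝓝[>] 0, ∀ k, a k ⬝ᵥ (x + ε • v) < b k := by
    rw [eventually_all]
    intro k
    refine Filter.Eventually.filter_mono nhdsWithin_le_nhds ?_
    have hc : Continuous fun ε : ℝ => a k ⬝ᵥ (x + ε • v) := by
      simp only [dotProduct_add, dotProduct_smul]
      fun_prop
    refine hc.continuousAt.eventually_lt continuousAt_const ?_
    simpa using hx k
  obtain ⟨ε, h1, h2⟩ := (h.and self_mem_nhdsWithin).exists
  exact ⟨ε, h2, h1⟩

/-- A face on which no inequality with nonzero linear part is tight throughout contains a point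
where all these inequalities are strict. That point is interior to `P`, so the linear form defining
the face is zero and the face is all of `P`. -/
theorem IsFace.exists_subset_tight {d : ℕ} {κ : Type*} [Fintype κ] (a : κ → Fin d → ℝ) (b : κ → ℝ)
    {P F : Set (Fin d → ℝ)} (hP : P = {x | ∀ k, a k ⬝ᵥ x ≤ b k})
    (hF : IsFace P F) (hne : F.Nonempty) (hFP : F ≠ P) :
    ∃ k, a k ≠ 0 ∧ ∀ x ∈ F, a k ⬝ᵥ x = b k := by
  classical
  by_contra! hcon
  obtain ⟨c, β, hc, rfl⟩ := hF
  obtain ⟨x₀, hx₀P, hx₀⟩ := hne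
  have hmem : ∀ x, x ∈ P ↔ ∀ k, a k ⬝ᵥ x ≤ b k := fun x => by rw [hP]; rfl
  -- for each nontrivial inequality choose a point of the face where it is strict
  have hpt : ∀ k, ∃ y, (y ∈ P ∧ c ⬝ᵥ y = β) ∧ (a k ≠ 0 → a k ⬝ᵥ y < b k) := by
    intro k
    by_cases hk : a k = 0
    · exact ⟨x₀, ⟨hx₀P, hx₀⟩, fun h => (h hk).elim⟩
    · obtain ⟨y, hy, hyk⟩ := hcon k hk
      exact ⟨y, hy, fun _ => lt_of_le_of_ne ((hmem y).1 hy.1 k) hyk⟩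
  choose y hy hyk using hpt
  -- the barycentre of the chosen points makes all nontrivial inequalities strict
  set n : ℝ := Fintype.card κ + 1 with hn
  have hn0 : 0 < n := by positivity
  set x : Fin d → ℝ := n⁻¹ • (x₀ + ∑ k, y k) with hxdef
  have hdot : ∀ u : Fin d → ℝ, u ⬝ᵥ x = n⁻¹ * (u ⬝ᵥ x₀ + ∑ k, u ⬝ᵥ y k) := by
    intro u
    simp [hxdef, dotProduct_add, dotProduct_sum, mul_add]
  have hcx : c ⬝ᵥ x = β := by
    rw [hdot, hx₀, Finset.sum_congr rfl fun k _ => (hy k).2]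
    simp only [Finset.sum_const, Finset.card_univ, nsmul_eq_mul]
    field_simp
    rw [hn]; ring
  have hax : ∀ k : {k // a k ≠ 0}, a k ⬝ᵥ x < b k := by
    rintro ⟨k, hk⟩
    have h1 : a k ⬝ᵥ x₀ ≤ b k := (hmem x₀).1 hx₀P k
    have h2 : ∑ l, a k ⬝ᵥ y l < ∑ _l : κ, b k :=
      Finset.sum_lt_sum (fun l _ => (hmem _).1 (hy l).1 k) ⟨k, Finset.mem_univ _, hyk k hk⟩
    simp only [Finset.sum_const, Finset.card_univ, nsmul_eq_mul] at h2
    change a k ⬝ᵥ x < b k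
    rw [hdot, inv_mul_lt_iff₀ hn0, hn]
    linarith
  -- so the valid inequality is maximized at an interior point, and its linear form vanishes
  obtain ⟨ε, hε, hlt⟩ := exists_pos_forall_dotProduct_add_smul_lt
    (fun k : {k // a k ≠ 0} => a k) (fun k => b k) x c hax
  have hxε : x + ε • c ∈ P := by
    rw [hmem]
    intro k
    by_cases hk : a k = 0
    · have := (hmem x₀).1 hx₀P k
      simpa [hk] using this
    · exact (hlt ⟨k, hk⟩).le
  have hle := hc _ hxε
  rw [dotProduct_add, hcx, dotProduct_smul, smul_eq_mul] at hle
  have hcc : c ⬝ᵥ c = 0 := by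
    have h0 : 0 ≤ c ⬝ᵥ c := Finset.sum_nonneg fun i _ => mul_self_nonneg _
    nlinarith
  have hc0 : c = 0 := dotProduct_self_eq_zero.mp hcc
  subst hc0
  apply hFP
  ext z
  simp only [zero_dotProduct] at hx₀ ⊢
  simp [hx₀]

/-- A full-dimensional polyhedron has at most as many facets as a system describing it has
inequalities. -/
theorem numFacets_le_card {d : ℕ} {κ : Type*} [Fintype κ] (a : κ → Fin d → ℝ) (b : κ → ℝ)
    {P : Set (Fin d → ℝ)} (hP : P = {x | ∀ k, a k ⬝ᵥ x ≤ b k}) (hspan : vectorSpan ℝ P = ⊤) :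
    numFacets P ≤ Fintype.card κ := by
  have hsub : {F | IsFacet P F} ⊆ Set.range fun k => {x | x ∈ P ∧ a k ⬝ᵥ x = b k} := by
    rintro F ⟨hface, hne, hdim⟩
    rw [affDim_eq_of_vectorSpan_eq_top hspan] at hdim
    have hFP : F ≠ P := by
      rintro rfl
      rw [affDim_eq_of_vectorSpan_eq_top hspan] at hdim
      omega
    obtain ⟨k, hk0, hk⟩ := hface.exists_subset_tight a b hP hne hFP
    refine ⟨k, ?_⟩
    obtain ⟨c, β, hc, rfl⟩ := hface
    refine Set.Subset.antisymm ?_ fun x hx => ⟨hx.1, hk x hx⟩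
    rintro x ⟨hxP, hx⟩
    refine ⟨hxP, ?_⟩
    obtain ⟨x₀, hx₀⟩ := hne
    -- both direction spaces are the hyperplane `ker (a k)`, on which `c` therefore vanishes
    have hle : vectorSpan ℝ {x | x ∈ P ∧ c ⬝ᵥ x = β} ≤
        LinearMap.ker (dotProductBilin ℝ ℝ (a k)) := fun v hv => by
      simpa using dotProduct_eq_zero_of_mem_vectorSpan hk hv
    have heq := Submodule.eq_of_le_of_finrank_eq hle (by
      have := finrank_ker_dotProduct hk0
      unfold affDim at hdim
      omega)
    have hmem : x - x₀ ∈ vectorSpan ℝ {x | x ∈ P ∧ c ⬝ᵥ x = β} := by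
      rw [heq]
      simp [dotProduct_sub, hx, hk x₀ hx₀]
    have h0 := dotProduct_eq_zero_of_mem_vectorSpan (fun y hy => hy.2) hmem
    rw [dotProduct_sub, hx₀.2] at h0
    linarith
  calc numFacets P ≤ (Set.range fun k => {x | x ∈ P ∧ a k ⬝ᵥ x = b k}).encard :=
        Set.encard_le_encard hsub
    _ ≤ (Set.univ : Set κ).encard := by
        rw [← Set.image_univ]; exact Set.encard_image_le _ _
    _ = Fintype.card κ := by simp

/-- A full-dimensional polyhedron has at least as many facets as an irredundant system describing
it has inequalities: each inequality is tight on a facet of its own. -/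
theorem card_le_numFacets {d : ℕ} {κ : Type*} [Fintype κ] (a : κ → Fin d → ℝ) (b : κ → ℝ)
    {P : Set (Fin d → ℝ)} (hP : P = {x | ∀ k, a k ⬝ᵥ x ≤ b k}) (hspan : vectorSpan ℝ P = ⊤)
    {x₀ : Fin d → ℝ} (hx₀ : ∀ k, a k ⬝ᵥ x₀ < b k)
    (hirr : ∀ k, ∃ y, b k < a k ⬝ᵥ y ∧ ∀ l, l ≠ k → a l ⬝ᵥ y ≤ b l) :
    (Fintype.card κ : ℕ∞) ≤ numFacets P := by
  have hmem : ∀ x, x ∈ P ↔ ∀ k, a k ⬝ᵥ x ≤ b k := fun x => by rw [hP]; rfl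
  -- the segment from `x₀` to the point violating only inequality `k` leaves `P` where only that
  -- inequality is tight
  have hz : ∀ k, ∃ z, a k ⬝ᵥ z = b k ∧ ∀ l, l ≠ k → a l ⬝ᵥ z < b l := by
    intro k
    obtain ⟨y, hy, hyl⟩ := hirr k
    have hxk := hx₀ k
    have hpos : 0 < a k ⬝ᵥ y - a k ⬝ᵥ x₀ := by linarith
    set s : ℝ := (b k - a k ⬝ᵥ x₀) / (a k ⬝ᵥ y - a k ⬝ᵥ x₀) with hs
    have hs0 : 0 ≤ s := div_nonneg (by linarith) hpos.le
    have hs1 : s < 1 := by rw [hs, div_lt_one hpos]; linarith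
    refine ⟨(1 - s) • x₀ + s • y, ?_, fun l hl => ?_⟩
    · have : s * (a k ⬝ᵥ y - a k ⬝ᵥ x₀) = b k - a k ⬝ᵥ x₀ := div_mul_cancel₀ _ hpos.ne'
      simp only [dotProduct_add, dotProduct_smul, smul_eq_mul]
      linarith
    · simp only [dotProduct_add, dotProduct_smul, smul_eq_mul]
      have h1 := hyl l hl
      have h2 := hx₀ l
      nlinarith
  choose z hzk hzl using hz
  have hzP : ∀ k, z k ∈ P := fun k => (hmem _).2 fun l => by
    by_cases hl : l = k
    · subst hl; exact (hzk l).le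
    · exact (hzl k l hl).le
  let G : κ → Set (Fin d → ℝ) := fun k => {x | x ∈ P ∧ a k ⬝ᵥ x = b k}
  have hinj : Function.Injective G := by
    intro k l hkl
    by_contra hne
    have h1 : z k ∈ G l := hkl ▸ ⟨hzP k, hzk k⟩
    exact (hzl k l (Ne.symm hne)).ne h1.2
  have hfacet : ∀ k, IsFacet P (G k) := by
    intro k
    have hak : a k ≠ 0 := by
      intro h0
      have h1 := hzk k
      have h2 := hx₀ k
      rw [h0, zero_dotProduct] at h1 h2
      linarith
    refine ⟨⟨a k, b k, fun x hx => (hmem x).1 hx k, rfl⟩, ⟨z k, hzP k, hzk k⟩, ?_⟩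
    rw [affDim_eq_of_vectorSpan_eq_top hspan]
    have heq : vectorSpan ℝ (G k) = LinearMap.ker (dotProductBilin ℝ ℝ (a k)) := by
      apply le_antisymm
      · intro v hv
        simpa using dotProduct_eq_zero_of_mem_vectorSpan (fun y (hy : y ∈ G k) => hy.2) hv
      · intro v hv
        have hv0 : a k ⬝ᵥ v = 0 := by simpa using hv
        obtain ⟨ε, hε, hlt⟩ := exists_pos_forall_dotProduct_add_smul_lt
          (fun l : {l // l ≠ k} => a l) (fun l => b l) (z k) v (fun l => hzl k l l.2)
        have hk : a k ⬝ᵥ (z k + ε • v) = b k := by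
          simp [dotProduct_add, hv0, hzk]
        have hin : z k + ε • v ∈ G k := by
          refine ⟨(hmem _).2 fun l => ?_, hk⟩
          by_cases hl : l = k
          · subst hl; exact hk.le
          · exact (hlt ⟨l, hl⟩).le
        have hsub := vsub_mem_vectorSpan ℝ hin (show z k ∈ G k from ⟨hzP k, hzk k⟩)
        rw [vsub_eq_sub, add_sub_cancel_left] at hsub
        exact (Submodule.smul_mem_iff _ hε.ne').1 hsub
    rw [affDim, heq]
    exact finrank_ker_dotProduct hak
  calc (Fintype.card κ : ℕ∞) = (Set.univ : Set κ).encard := by simp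
    _ = (G '' Set.univ).encard := (hinj.injOn.encard_image).symm
    _ ≤ numFacets P := Set.encard_le_encard (by rintro _ ⟨k, -, rfl⟩; exact hfacet k)

/-! ### The rational lower bound -/

theorem vectorSpan_eq_top_of_stdSimplexVertices_subset {d : ℕ} {P : Set (Fin d → ℝ)}
    (h : stdSimplexVertices d ⊆ P) : vectorSpan ℝ P = ⊤ := by
  rw [eq_top_iff, ← (Pi.basisFun ℝ (Fin d)).span_eq, Submodule.span_le]
  rintro _ ⟨i, rfl⟩
  have := vsub_mem_vectorSpan ℝ (h (Or.inr ⟨i, rfl⟩) : Pi.single i (1 : ℝ) ∈ P)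
    (h (Or.inl rfl) : (0 : Fin d → ℝ) ∈ P)
  simpa using this

/-- At most `d` rational homogeneous inequalities in `d ≥ 1` variables have a nonzero integer
solution: a kernel vector, or a preimage of `-1` when the matrix is invertible. -/
theorem exists_ne_zero_int_mulVec_nonpos {m d : ℕ} (hd : 1 ≤ d) (hmd : m ≤ d)
    (A : Matrix (Fin m) (Fin d) ℚ) :
    ∃ v : Fin d → ℤ, v ≠ 0 ∧ ∀ k, A k ⬝ᵥ (fun i => (v i : ℚ)) ≤ 0 := by
  obtain ⟨q, hq0, hq⟩ : ∃ q : Fin d → ℚ, q ≠ 0 ∧ ∀ k, A k ⬝ᵥ q ≤ 0 := by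
    by_cases hinj : Function.Injective A.mulVecLin
    · have hdm : d ≤ m := by simpa using LinearMap.finrank_le_finrank_of_injective hinj
      obtain rfl : m = d := le_antisymm hmd hdm
      obtain ⟨q, hq⟩ := (LinearMap.injective_iff_surjective.1 hinj) (fun _ => -1)
      have hk : ∀ k, A k ⬝ᵥ q = -1 := fun k => congrFun hq k
      refine ⟨q, ?_, fun k => by rw [hk]; norm_num⟩
      rintro rfl
      have := hk ⟨0, hd⟩
      simp at this
    · rw [← LinearMap.ker_eq_bot, Submodule.eq_bot_iff] at hinj
      push Not at hinj
      obtain ⟨q, hq, hq0⟩ := hinj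
      exact ⟨q, hq0, fun k => (congrFun (LinearMap.mem_ker.1 hq) k).le⟩
  obtain ⟨N, hN⟩ := IsLocalization.exist_integer_multiples_of_finite (nonZeroDivisors ℤ) q
  choose w hw using hN
  have hN0 : (N : ℤ) ≠ 0 := nonZeroDivisors.coe_ne_zero N
  -- multiply by the square of the denominator, whose sign is known
  have hv : ∀ i, ((N * w i : ℤ) : ℚ) = (N : ℚ) ^ 2 * q i := by
    intro i
    have h := hw i
    simp only [algebraMap_int_eq, eq_intCast, zsmul_eq_mul] at h
    push_cast
    rw [h]; ring
  refine ⟨fun i => N * w i, fun h0 => hq0 ?_, fun k => ?_⟩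
  · ext i
    have h1 := hv i
    rw [congrFun h0 i] at h1
    have : ((N : ℤ) : ℚ) ≠ 0 := by exact_mod_cast hN0
    simpa [this] using h1.symm
  · have h1 : (fun i => ((N * w i : ℤ) : ℚ)) = (N : ℚ) ^ 2 • q := funext hv
    rw [h1, dotProduct_smul]
    exact mul_nonpos_of_nonneg_of_nonpos (sq_nonneg _) (hq k)

/-- An inequality valid on the vertices of the standard simplex with nonzero linear part is strict
at the barycentre. -/
theorem dotProduct_barycentre_lt {d : ℕ} {a : Fin d → ℝ} {β : ℝ}
    (h : ∀ x ∈ stdSimplexVertices d, a ⬝ᵥ x ≤ β) (ha : a ≠ 0) :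
    a ⬝ᵥ (fun _ => ((d : ℝ) + 1)⁻¹) < β := by
  have h0 : 0 ≤ β := by simpa using h 0 (Or.inl rfl)
  have hi : ∀ i, a i ≤ β := fun i => by simpa using h _ (Or.inr ⟨i, rfl⟩)
  have hd : (0 : ℝ) < d + 1 := by positivity
  have heq : a ⬝ᵥ (fun _ => ((d : ℝ) + 1)⁻¹) = ((d : ℝ) + 1)⁻¹ * ∑ i, a i := by
    rw [dotProduct, ← Finset.sum_mul, mul_comm]
  rw [heq, inv_mul_lt_iff₀ hd]
  obtain hβ | hβ := h0.lt_or_eq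
  · have : ∑ i, a i ≤ ∑ _i : Fin d, β := Finset.sum_le_sum fun i _ => hi i
    simp at this
    linarith
  · subst hβ
    obtain ⟨i, hi0⟩ := Function.ne_iff.1 ha
    have : ∑ i, a i < ∑ _i : Fin d, (0 : ℝ) :=
      Finset.sum_lt_sum (fun i _ => hi i) ⟨i, Finset.mem_univ _, lt_of_le_of_ne (hi i) hi0⟩
    simpa using this

/-- A rational relaxation of the standard simplex has at least `d + 1` facets: with fewer
inequalities its recession cone contains a nonzero integer vector, along which there are
infinitely many integer points. -/
theorem add_one_le_numFacets_of_isRationalPolyhedron {d : ℕ} (hd : 1 ≤ d) {P : Set (Fin d → ℝ)}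
    (hP : IsRationalPolyhedron P) (hX : stdSimplexVertices d = P ∩ integerPoints d) :
    ((d + 1 : ℕ) : ℕ∞) ≤ numFacets P := by
  classical
  have hsub : stdSimplexVertices d ⊆ P := by rw [hX]; exact Set.inter_subset_left
  -- a shortest rational system is irredundant
  obtain ⟨A, b, hAb⟩ := Nat.find_spec hP
  have hmin := fun l => Nat.find_min hP (m := l)
  generalize Nat.find hP = m at A b hAb hmin
  have hmem : ∀ x, x ∈ P ↔ ∀ i, (fun j => (A i j : ℝ)) ⬝ᵥ x ≤ (b i : ℝ) :=
    fun x => by rw [hAb]; rfl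
  have hirr : ∀ k, ∃ y : Fin d → ℝ, (b k : ℝ) < (fun j => (A k j : ℝ)) ⬝ᵥ y ∧
      ∀ l, l ≠ k → (fun j => (A l j : ℝ)) ⬝ᵥ y ≤ (b l : ℝ) := by
    intro k
    by_contra! hcon
    obtain _ | n := m
    · exact k.elim0
    refine hmin n (Nat.lt_succ_self n) ⟨fun i => A (k.succAbove i), fun i => b (k.succAbove i), ?_⟩
    ext y
    rw [hmem]
    refine ⟨fun h i => h _, fun h i => ?_⟩
    have hne : ∀ l, l ≠ k → (fun j => (A l j : ℝ)) ⬝ᵥ y ≤ (b l : ℝ) := by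
      intro l hl
      obtain ⟨i, rfl⟩ := Fin.exists_succAbove_eq hl
      exact h i
    by_cases hik : i = k
    · subst hik
      by_contra! hlt
      obtain ⟨l, hl, hl'⟩ := hcon y hlt
      exact hl'.not_ge (hne l hl)
    · exact hne i hik
  have hmP : (m : ℕ∞) ≤ numFacets P := by
    have h := card_le_numFacets (fun k j => (A k j : ℝ)) (fun k => (b k : ℝ)) hAb
      (vectorSpan_eq_top_of_stdSimplexVertices_subset hsub)
      (x₀ := fun _ => ((d : ℝ) + 1)⁻¹) (fun k => ?_) hirr
    · simpa using h
    · refine dotProduct_barycentre_lt (fun x hx => (hmem x).1 (hsub hx) k) fun h0 => ?_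
      obtain ⟨y, hy, -⟩ := hirr k
      have h1 := (hmem 0).1 (hsub (Or.inl rfl)) k
      rw [h0] at hy
      simp only [zero_dotProduct, dotProduct_zero] at hy h1
      exact hy.not_ge h1
  refine le_trans ?_ hmP
  norm_cast
  by_contra! hlt
  obtain ⟨v, hv0, hv⟩ := exists_ne_zero_int_mulVec_nonpos hd (Nat.lt_succ_iff.1 hlt) A
  have hvR : ∀ k, (fun j => (A k j : ℝ)) ⬝ᵥ (fun i => (v i : ℝ)) ≤ 0 := by
    intro k
    have := hv k
    simp only [dotProduct] at this ⊢
    exact_mod_cast this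
  -- `v` and `2 v` are then both vertices of the simplex
  have hmul : ∀ c : ℕ, (fun i => ((c * v i : ℤ) : ℝ)) ∈ stdSimplexVertices d := by
    intro c
    rw [hX]
    refine ⟨(hmem _).2 fun k => ?_, ⟨fun i => c * v i, rfl⟩⟩
    have h1 := (hmem 0).1 (hsub (Or.inl rfl)) k
    rw [dotProduct_zero] at h1
    have h2 : (fun i => ((c * v i : ℤ) : ℝ)) = (c : ℝ) • fun i => (v i : ℝ) := by
      ext i; simp
    rw [h2, dotProduct_smul]
    exact (mul_nonpos_of_nonneg_of_nonpos (Nat.cast_nonneg c) (hvR k)).trans h1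
  obtain ⟨i, hi⟩ := Function.ne_iff.1 hv0
  have hcoord : ∀ c : ℕ, (c * v i : ℤ) = 0 ∨ (c * v i : ℤ) = 1 := by
    intro c
    obtain h | ⟨j, h⟩ := hmul c
    · have h' : ((c * v i : ℤ) : ℝ) = 0 := congrFun h i
      left; exact_mod_cast h'
    · have h' : (Pi.single j (1 : ℝ) : Fin d → ℝ) i = ((c * v i : ℤ) : ℝ) := congrFun h i
      by_cases hij : i = j
      · subst hij
        rw [Pi.single_eq_same] at h'
        right; exact_mod_cast h'.symm
      · rw [Pi.single_eq_of_ne hij] at h'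
        left; exact_mod_cast h'.symm
  have h1 := hcoord 1
  have h2 := hcoord 2
  have h3 : v i ≠ 0 := hi
  omega

theorem add_one_le_rcRat_stdSimplexVertices {d : ℕ} (hd : 1 ≤ d) :
    ((d + 1 : ℕ) : ℕ∞) ≤ rcRat (stdSimplexVertices d) := by
  refine le_sInf ?_
  rintro k ⟨P, hP, hX, rfl⟩
  exact add_one_le_numFacets_of_isRationalPolyhedron hd hP hX

/-! ### Relaxations in barycentric coordinates -/

/-- The barycentric coordinates of `x : Fin d → R` with respect to `0, e_1, …, e_d`, indexed by
`Option (Fin d)` with `none` standing for the vertex `0`. -/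
def simplexCoord {R : Type*} [CommRing R] {d : ℕ} (x : Fin d → R) : Option (Fin d) → R :=
  fun o => o.elim (1 - ∑ i, x i) x

theorem sum_simplexCoord {R : Type*} [CommRing R] {d : ℕ} (x : Fin d → R) :
    ∑ o, simplexCoord x o = 1 := by
  simp [Fintype.sum_option, simplexCoord]

theorem simplexCoord_intCast {d : ℕ} (z : Fin d → ℤ) (o : Option (Fin d)) :
    simplexCoord (fun i => (z i : ℝ)) o = (simplexCoord z o : ℤ) := by
  cases o <;> simp [simplexCoord]

/-- In barycentric coordinates, an affine inequality on `ℝ^d` is `∑ o, γ o * t o ≥ 0`. -/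
theorem dotProduct_le_iff_sum_simplexCoord {d : ℕ} (γ : Option (Fin d) → ℝ) (x : Fin d → ℝ) :
    (fun i => γ none - γ (some i)) ⬝ᵥ x ≤ γ none ↔ 0 ≤ ∑ o, γ o * simplexCoord x o := by
  simp only [dotProduct, Fintype.sum_option, simplexCoord, Option.elim, sub_mul,
    Finset.sum_sub_distrib, mul_sub, ← Finset.mul_sum]
  constructor <;> intro h <;> linarith

theorem sum_mul_simplexCoord_nonneg {d : ℕ} {γ : Option (Fin d) → ℝ} (hγ : ∀ o, 0 ≤ γ o)
    {x : Fin d → ℝ} (hx : x ∈ stdSimplexVertices d) : 0 ≤ ∑ o, γ o * simplexCoord x o := by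
  obtain rfl | ⟨i, rfl⟩ := hx
  · simp [Fintype.sum_option, simplexCoord, hγ]
  · simp [Fintype.sum_option, simplexCoord, hγ, Pi.single_apply]

theorem stdSimplexVertices_subset_integerPoints (d : ℕ) :
    stdSimplexVertices d ⊆ integerPoints d := by
  rintro _ (rfl | ⟨i, rfl⟩)
  · exact ⟨0, by ext; simp⟩
  · refine ⟨Pi.single i 1, ?_⟩
    ext j
    by_cases h : j = i
    · subst h; simp
    · simp [h]

/-- Integer barycentric coordinates are those of a vertex if they vanish off a fibre of an
injective map and equal `1` on it. -/
theorem intCast_mem_stdSimplexVertices {d : ℕ} {Q : Type*} {φ : Option (Fin d) → Q}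
    (hφ : Function.Injective φ) {q : Q} {z : Fin d → ℤ}
    (h0 : ∀ o, φ o ≠ q → simplexCoord z o = 0) (h1 : ∀ o, φ o = q → simplexCoord z o = 1) :
    (fun i => (z i : ℝ)) ∈ stdSimplexVertices d := by
  by_cases h : ∃ i, φ (some i) = q
  · obtain ⟨i, hi⟩ := h
    refine Or.inr ⟨i, ?_⟩
    ext j
    by_cases hj : j = i
    · subst hj
      have : z j = 1 := h1 (some j) hi
      simp [this]
    · have : z j = 0 := h0 (some j) fun hc => hj (Option.some.inj (hφ (hc.trans hi.symm)))
      simp [hj, this]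
  · push Not at h
    left
    ext j
    have : z j = 0 := h0 (some j) (h j)
    simp [this]

/-- The relaxation of the simplex cut out by the inequalities `∑ o, γ k o * t o ≥ 0`
in barycentric coordinates, provided that they exclude all other integer points. -/
theorem numFacets_le_card_of_simplexCoord {d : ℕ} {κ : Type*} [Fintype κ]
    (γ : κ → Option (Fin d) → ℝ) (hγ : ∀ k o, 0 ≤ γ k o)
    (hint : ∀ z : Fin d → ℤ, (∀ k, 0 ≤ ∑ o, γ k o * ((simplexCoord z o : ℤ) : ℝ)) →
      (fun i => (z i : ℝ)) ∈ stdSimplexVertices d) :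
    ∃ P : Set (Fin d → ℝ), P = {x | ∀ k, (fun i => γ k none - γ k (some i)) ⬝ᵥ x ≤ γ k none} ∧
      stdSimplexVertices d = P ∩ integerPoints d ∧ numFacets P ≤ Fintype.card κ := by
  refine ⟨_, rfl, ?_, ?_⟩
  · refine Set.Subset.antisymm (fun x hx => ⟨fun k => ?_, ?_⟩) ?_
    · rw [dotProduct_le_iff_sum_simplexCoord]
      exact sum_mul_simplexCoord_nonneg (hγ k) hx
    · exact stdSimplexVertices_subset_integerPoints d hx
    · rintro _ ⟨hx, z, rfl⟩
      refine hint z fun k => ?_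
      have := (dotProduct_le_iff_sum_simplexCoord (γ k) _).1 (hx k)
      simpa only [simplexCoord_intCast] using this
  · refine numFacets_le_card _ _ rfl (vectorSpan_eq_top_of_stdSimplexVertices_subset ?_)
    intro x hx k
    rw [dotProduct_le_iff_sum_simplexCoord]
    exact sum_mul_simplexCoord_nonneg (hγ k) hx

theorem rc_le_card_of_simplexCoord {d : ℕ} {κ : Type*} [Fintype κ]
    (γ : κ → Option (Fin d) → ℝ) (hγ : ∀ k o, 0 ≤ γ k o)
    (hint : ∀ z : Fin d → ℤ, (∀ k, 0 ≤ ∑ o, γ k o * ((simplexCoord z o : ℤ) : ℝ)) →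
      (fun i => (z i : ℝ)) ∈ stdSimplexVertices d) :
    rc (stdSimplexVertices d) ≤ Fintype.card κ := by
  obtain ⟨P, hP, hX, hcard⟩ := numFacets_le_card_of_simplexCoord γ hγ hint
  refine le_trans (sInf_le ⟨P, ?_, hX, rfl⟩) hcard
  let e := (Fintype.equivFin κ).symm
  refine ⟨Fintype.card κ, fun k i => γ (e k) none - γ (e k) (some i), fun k => γ (e k) none, ?_⟩
  rw [hP]
  ext x
  exact e.forall_congr_right.symm

/-- Nonnegative integers with sum `1` are the coordinates of a unit vector. -/
theorem exists_eq_ite_of_sum_eq_one {ι : Type*} [Fintype ι] [DecidableEq ι] {r : ι → ℤ}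
    (h0 : ∀ i, 0 ≤ r i) (h1 : ∑ i, r i = 1) : ∃ i₀, ∀ i, r i = if i = i₀ then 1 else 0 := by
  obtain ⟨i₀, hi₀⟩ : ∃ i₀, r i₀ ≠ 0 := by
    by_contra! h
    simp [h] at h1
  have hpos : 1 ≤ r i₀ := by have := h0 i₀; omega
  have hsum := Finset.add_sum_erase Finset.univ r (Finset.mem_univ i₀)
  have hrest : 0 ≤ ∑ i ∈ Finset.univ.erase i₀, r i := Finset.sum_nonneg fun i _ => h0 i
  refine ⟨i₀, fun i => ?_⟩
  split_ifs with h
  · subst h; omega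
  · have hz : ∑ i ∈ Finset.univ.erase i₀, r i = 0 := by omega
    exact (Finset.sum_eq_zero_iff_of_nonneg fun i _ => h0 i).1 hz i (by simp [h])

theorem rcRat_stdSimplexVertices_ne_top (d : ℕ) : rcRat (stdSimplexVertices d) ≠ ⊤ := by
  classical
  let δ : Option (Fin d) → Option (Fin d) → ℚ := fun k o => if o = k then 1 else 0
  obtain ⟨P, hP, hX, hcard⟩ := numFacets_le_card_of_simplexCoord (fun k o => (δ k o : ℝ))
    (fun k o => by simp only [δ]; split_ifs <;> simp) (fun z hz => by
      have hz' : ∀ o, 0 ≤ simplexCoord z o := fun o => by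
        have := hz o
        simp only [δ, apply_ite (Rat.cast : ℚ → ℝ), Rat.cast_one, Rat.cast_zero, ite_mul, one_mul,
          zero_mul, Finset.sum_ite_eq', Finset.mem_univ, if_true] at this
        exact_mod_cast this
      obtain ⟨o₀, ho₀⟩ := exists_eq_ite_of_sum_eq_one hz' (sum_simplexCoord z)
      exact intCast_mem_stdSimplexVertices Function.injective_id (q := o₀)
        (fun o ho => (ho₀ o).trans (if_neg ho)) (fun o ho => (ho₀ o).trans (if_pos ho)))
  refine ne_top_of_le_ne_top (ENat.natCast_ne_top _) (le_trans (sInf_le ⟨P, ?_, hX, rfl⟩) hcard)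
  let e := (Fintype.equivFin (Option (Fin d))).symm
  refine ⟨_, fun k i => δ (e k) none - δ (e k) (some i), fun k => δ (e k) none, ?_⟩
  rw [hP]
  ext x
  simp only [Rat.cast_sub]
  exact e.forall_congr_right.symm

/-! ### An irrational relaxation with few inequalities -/

theorem exists_linearIndependent_rat_real (Q : Type*) [Fintype Q] :
    ∃ h : Q → ℝ, LinearIndependent ℚ h := by
  obtain ⟨f, hf⟩ := exists_linearIndependent_of_le_rank (R := ℚ) (M := ℝ) (n := Fintype.card Q) (by
    rw [Real.rank_rat_real]
    exact (Cardinal.natCast_lt_aleph0.le).trans Cardinal.aleph0_le_continuum)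
  exact ⟨f ∘ Fintype.equivFin Q, hf.comp _ (Fintype.equivFin Q).injective⟩

/-- If the `h q` are linearly independent over `ℚ`, an integer combination of them equal to some
`h q` is the trivial one. -/
theorem simplexCoord_eq_of_sum_eq {d : ℕ} {Q : Type*} [Fintype Q] [DecidableEq Q] {h : Q → ℝ}
    (hh : LinearIndependent ℚ h) {φ : Option (Fin d) → Q} (hφ : Function.Injective φ)
    (t : Option (Fin d) → ℤ) {q : Q} (hsum : ∑ o, h (φ o) * (t o : ℝ) = h q) (o : Option (Fin d)) :
    t o = if φ o = q then 1 else 0 := by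
  have hfib : ∀ p, (∑ o', if φ o' = p then (t o' : ℚ) else 0) - (if p = q then 1 else 0) = 0 := by
    refine Fintype.linearIndependent_iff.1 hh _ ?_
    have h1 : ∀ p, ((∑ o', if φ o' = p then (t o' : ℚ) else 0) - (if p = q then 1 else 0)) • h p
        = (∑ o', if φ o' = p then h (φ o') * (t o' : ℝ) else 0) - if p = q then h q else 0 := by
      intro p
      rw [sub_smul, Finset.sum_smul]
      congr 1
      · refine Finset.sum_congr rfl fun o' _ => ?_
        split_ifs with hp
        · rw [hp, Rat.smul_def]; push_cast; ring
        · simp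
      · split_ifs with hp
        · rw [hp, one_smul]
        · simp
    rw [Finset.sum_congr rfl fun p _ => h1 p, Finset.sum_sub_distrib, Finset.sum_comm]
    simp [hsum]
  have h2 := hfib (φ o)
  simp only [hφ.eq_iff, Finset.sum_ite_eq', Finset.mem_univ, if_true, sub_eq_zero] at h2
  exact_mod_cast h2

/-- The nonnegative functions on the grid `S × S` that cut out the irrational relaxation:
indicators of rows and of columns, and for each column `j` the two functions
`± (h (i, j') - h (i, j)) + M [j' ≠ j]`, which vanish on column `j`. -/
noncomputable def gridFun {S : Type*} [DecidableEq S] (h : S × S → ℝ) (M : ℝ) :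
    (S ⊕ S) ⊕ (S ⊕ S) → S × S → ℝ
  | .inl (.inl i), q => if q.1 = i then 1 else 0
  | .inl (.inr j), q => if q.2 = j then 1 else 0
  | .inr (.inl j), q => (h q - h (q.1, j)) + M * (1 - if q.2 = j then 1 else 0)
  | .inr (.inr j), q => -(h q - h (q.1, j)) + M * (1 - if q.2 = j then 1 else 0)

theorem gridFun_nonneg {S : Type*} [DecidableEq S] {h : S × S → ℝ} {M : ℝ}
    (hM : ∀ p q, |h p - h q| ≤ M) : ∀ k q, 0 ≤ gridFun h M k q
  | .inl (.inl i), q => by simp only [gridFun]; split_ifs <;> simp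
  | .inl (.inr j), q => by simp only [gridFun]; split_ifs <;> simp
  | .inr (.inl j), (i, j') => by
    have := abs_le.1 (hM (i, j') (i, j))
    simp only [gridFun]
    split_ifs with hj
    · simp [hj]
    · linarith
  | .inr (.inr j), (i, j') => by
    have := abs_le.1 (hM (i, j') (i, j))
    simp only [gridFun]
    split_ifs with hj
    · simp [hj]
    · linarith

/-- Integer weights on the grid with total `1` satisfying the inequalities of `gridFun` have unit
vectors as row and column sums, and the inequalities of the nonzero column pin the weighted sum of
`h` to the value of `h` at the corresponding cell. -/
theorem exists_sum_eq_of_gridFun {S O : Type*} [Fintype S] [DecidableEq S] [Fintype O]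
    {h : S × S → ℝ} {M : ℝ} (φ : O → S × S) {t : O → ℤ} (ht : ∑ o, t o = 1)
    (hk : ∀ k, 0 ≤ ∑ o, gridFun h M k (φ o) * (t o : ℝ)) :
    ∃ q, ∑ o, h (φ o) * (t o : ℝ) = h q := by
  have hunit : ∀ f : O → S, (∀ i, 0 ≤ ∑ o, (if f o = i then (1 : ℝ) else 0) * (t o : ℝ)) →
      ∃ i₀, ∀ i, ∑ o, (if f o = i then (1 : ℝ) else 0) * (t o : ℝ) = if i = i₀ then 1 else 0 := by
    intro f hf
    have hcast : ∀ i, ∑ o, (if f o = i then (1 : ℝ) else 0) * (t o : ℝ)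
        = ((∑ o, if f o = i then t o else 0 : ℤ) : ℝ) := fun i => by
      push_cast
      refine Finset.sum_congr rfl fun o _ => ?_
      split_ifs <;> simp
    obtain ⟨i₀, hi₀⟩ := exists_eq_ite_of_sum_eq_one (r := fun i => ∑ o, if f o = i then t o else 0)
      (fun i => by have := hf i; rw [hcast] at this; exact_mod_cast this)
      (by rw [Finset.sum_comm]; simpa using ht)
    refine ⟨i₀, fun i => ?_⟩
    rw [hcast, hi₀]
    push_cast
    rfl
  obtain ⟨i₀, hi₀⟩ := hunit (fun o => (φ o).1) fun i => hk (.inl (.inl i))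
  obtain ⟨j₀, hj₀⟩ := hunit (fun o => (φ o).2) fun j => hk (.inl (.inr j))
  have ht' : ∑ o, (t o : ℝ) = 1 := by exact_mod_cast ht
  -- column `j₀` of `h`, weighted by the row sums, contributes `h (i₀, j₀)`
  have hrow : ∑ o, h ((φ o).1, j₀) * (t o : ℝ) = h (i₀, j₀) := by
    have h1 : ∀ o, h ((φ o).1, j₀) * (t o : ℝ)
        = ∑ i, h (i, j₀) * ((if (φ o).1 = i then (1 : ℝ) else 0) * (t o : ℝ)) := fun o => by
      simp
    rw [Finset.sum_congr rfl fun o _ => h1 o, Finset.sum_comm]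
    simp only [← Finset.mul_sum, hi₀]
    simp
  have hcol : ∑ o, (1 - if (φ o).2 = j₀ then (1 : ℝ) else 0) * (t o : ℝ) = 0 := by
    simp only [sub_mul, Finset.sum_sub_distrib, one_mul, ht', hj₀ j₀, if_true, sub_self]
  have hexp : ∀ c : ℝ, ∑ o, (c * (h (φ o) - h ((φ o).1, j₀)) +
      M * (1 - if (φ o).2 = j₀ then 1 else 0)) * (t o : ℝ)
        = c * (∑ o, h (φ o) * (t o : ℝ) - h (i₀, j₀)) := by
    intro c
    have hsplit : ∀ o, (c * (h (φ o) - h ((φ o).1, j₀)) +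
        M * (1 - if (φ o).2 = j₀ then 1 else 0)) * (t o : ℝ)
          = c * (h (φ o) * (t o : ℝ) - h ((φ o).1, j₀) * (t o : ℝ)) +
            M * ((1 - if (φ o).2 = j₀ then 1 else 0) * (t o : ℝ)) := fun o => by ring
    rw [Finset.sum_congr rfl fun o _ => hsplit o, Finset.sum_add_distrib, ← Finset.mul_sum,
      ← Finset.mul_sum, hcol, Finset.sum_sub_distrib, hrow, mul_zero, add_zero]
  have hup := hk (.inr (.inr j₀))
  have hlow := hk (.inr (.inl j₀))
  have hneg := hexp (-1)
  have hpos := hexp 1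
  simp only [gridFun] at hup hlow
  simp only [neg_one_mul] at hneg
  simp only [one_mul] at hpos
  rw [hneg] at hup
  rw [hpos] at hlow
  exact ⟨(i₀, j₀), by linarith⟩

/-- Placing the `d + 1` vertices injectively on an `s × s` grid gives a relaxation with `4 s`
inequalities. -/
theorem rc_stdSimplexVertices_le {d s : ℕ} (hs : d + 1 ≤ s * s) :
    rc (stdSimplexVertices d) ≤ ((4 * s : ℕ) : ℕ∞) := by
  classical
  obtain ⟨φ⟩ : Nonempty (Option (Fin d) ↪ Fin s × Fin s) :=
    Function.Embedding.nonempty_of_card_le (by simpa using hs)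
  obtain ⟨h, hh⟩ := exists_linearIndependent_rat_real (Fin s × Fin s)
  obtain ⟨M, hM⟩ : ∃ M, ∀ p q, |h p - h q| ≤ M := by
    obtain ⟨M, hM⟩ := (Set.finite_range fun r : (Fin s × Fin s) × (Fin s × Fin s) =>
      |h r.1 - h r.2|).bddAbove
    exact ⟨M, fun p q => hM ⟨(p, q), rfl⟩⟩
  have hle := rc_le_card_of_simplexCoord (fun k o => gridFun h M k (φ o))
    (fun k o => gridFun_nonneg hM k (φ o)) (fun z hz => by
      obtain ⟨q, hq⟩ := exists_sum_eq_of_gridFun φ (sum_simplexCoord z) hz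
      have ht := simplexCoord_eq_of_sum_eq hh φ.injective _ hq
      exact intCast_mem_stdSimplexVertices φ.injective (q := q)
        (fun o ho => by rw [ht, if_neg ho]) (fun o ho => by rw [ht, if_pos ho]))
  refine hle.trans (le_of_eq ?_)
  congr 1
  simp only [Fintype.card_sum, Fintype.card_fin]
  ring

theorem rc_stdSimplexVertices_le_sqrt (d : ℕ) :
    rc (stdSimplexVertices d) ≤ ((4 * (Nat.sqrt d + 1) : ℕ) : ℕ∞) :=
  rc_stdSimplexVertices_le (Nat.succ_le_of_lt (Nat.lt_succ_sqrt d))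

/-! ### Asymptotics -/

theorem toNat_rc_stdSimplexVertices_le {d : ℕ} (hd : 1 ≤ d) :
    ((rc (stdSimplexVertices d)).toNat : ℝ) ≤ 8 * √(d : ℝ) := by
  have h1 : (rc (stdSimplexVertices d)).toNat ≤ 4 * (Nat.sqrt d + 1) :=
    ENat.toNat_le_of_le_natCast (rc_stdSimplexVertices_le_sqrt d)
  have h2 : ((rc (stdSimplexVertices d)).toNat : ℝ) ≤ 4 * (Nat.sqrt d + 1) := by exact_mod_cast h1
  have h3 : (Nat.sqrt d : ℝ) ≤ √(d : ℝ) := Real.nat_sqrt_le_real_sqrt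
  have h4 : (1 : ℝ) ≤ √(d : ℝ) := Real.one_le_sqrt.2 (by exact_mod_cast hd)
  linarith

theorem theorem3 :
    -- all quantities are finite, and the denominator of the ratio is nonzero for `d ≥ 1`
    (∀ d : ℕ, rc (stdSimplexVertices d) ≠ ⊤ ∧ rcRat (stdSimplexVertices d) ≠ ⊤) ∧
    (∀ d : ℕ, 1 ≤ d → rcRat (stdSimplexVertices d) ≠ 0) ∧
    (fun d : ℕ => ((rc (stdSimplexVertices d)).toNat : ℝ))
      =O[atTop] (fun d : ℕ => (d : ℝ) / Real.sqrt (Real.log (d : ℝ))) ∧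
    Tendsto
      (fun d : ℕ => ((rc (stdSimplexVertices d)).toNat : ℝ) /
        ((rcRat (stdSimplexVertices d)).toNat : ℝ))
      atTop (𝓝 0) := by
  refine ⟨fun d => ⟨?_, rcRat_stdSimplexVertices_ne_top d⟩, fun d hd h0 => ?_, ?_, ?_⟩
  · exact ne_top_of_le_ne_top (ENat.natCast_ne_top _) (rc_stdSimplexVertices_le_sqrt d)
  · have h := add_one_le_rcRat_stdSimplexVertices hd
    rw [h0] at h
    norm_cast at h
  · refine IsBigO.of_bound 8 ?_
    filter_upwards [eventually_ge_atTop 2] with d hd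
    have hd1 : (1 : ℝ) < d := by exact_mod_cast hd
    have hlog : 0 < Real.log d := Real.log_pos hd1
    have hle : √(Real.log d) ≤ √(d : ℝ) := Real.sqrt_le_sqrt (Real.log_le_self (by linarith))
    have hpos : 0 < √(Real.log d) := Real.sqrt_pos.2 hlog
    rw [Real.norm_of_nonneg (Nat.cast_nonneg _), Real.norm_of_nonneg (by positivity)]
    refine (toNat_rc_stdSimplexVertices_le (by omega)).trans ?_
    gcongr
    rw [le_div_iff₀ hpos]
    calc √(d : ℝ) * √(Real.log d) ≤ √(d : ℝ) * √(d : ℝ) := by gcongr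
      _ = d := Real.mul_self_sqrt (by linarith)
  · have hlim : Tendsto (fun d : ℕ => 8 * (√(d : ℝ))⁻¹) atTop (𝓝 0) := by
      have h := (tendsto_inv_atTop_zero.comp
        (Real.tendsto_sqrt_atTop.comp tendsto_natCast_atTop_atTop)).const_mul (8 : ℝ)
      simpa using h
    refine squeeze_zero' (Eventually.of_forall fun d => by positivity) ?_ hlim
    filter_upwards [eventually_ge_atTop 1] with d hd
    have hd0 : (0 : ℝ) < d := by exact_mod_cast hd
    have hq : d + 1 ≤ (rcRat (stdSimplexVertices d)).toNat := by
      have h := add_one_le_rcRat_stdSimplexVertices hd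
      rw [← ENat.natCast_toNat (rcRat_stdSimplexVertices_ne_top d)] at h
      exact_mod_cast h
    have hq' : (d : ℝ) ≤ (rcRat (stdSimplexVertices d)).toNat := by
      exact_mod_cast (Nat.le_succ d).trans hq
    calc ((rc (stdSimplexVertices d)).toNat : ℝ) / ((rcRat (stdSimplexVertices d)).toNat : ℝ)
        ≤ 8 * √(d : ℝ) / d := by
          gcongr
          exact toNat_rc_stdSimplexVertices_le hd
      _ = 8 * (√(d : ℝ))⁻¹ := by
          rw [mul_div_assoc, Real.sqrt_div_self', one_div]
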